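/- Let $n\ge 1$, $p\in(0,1)$, $\sigma>0$. Client $i\in[n]$ receives a query $x_i\in\mathbb R^l$ and holds a local model $f_i:\mathbb R^l\to\mathbb R^k$, obtained by one of three fusion methods (the same for all clients) from class scores $r_i(x)\in\mathbb R^k$ that are nonnegative with sum $1$: $f_i(x)$ is the mean-centered version ($u\mapsto u-\bar u\mathbf 1$, with $\bar u$ the mean of the entries of $u$) of (a) $r_i(x)$; or (b) $w_i\odot r_i(x)$, where $w_i$ is a fixed nonnegative weight vector with sum $1$; or (c) the one-hot vector of a class with maximal score in $r_i(x)$. Algorithm 1 (over-the-air private collaborative inference). Let $S\subseteq[n]$ contain each client independently with probability $p$, conditioned on $S\neq\emptyset$. Given $S$, each $i\in S$ forms $g_i=f_i(x_i)+m_i$ with independent noises $m_i\sim\mathcal N(0,\tfrac{\sigma^2}{|S|}I_k)$ and transmits $\gamma A g_i/(|S|h_i)$, where $A\in\mathbb R^{d\times k}$ is a fixed projection matrix, $h_i\ne0$ is the channel gain of client $i$, and $\gamma=|S|\,c$ with a constant $c\in\mathbb R$ that does not depend on $S$. The server receives $$z=\sum_{i\in S}h_i\,\frac{\gamma A g_i}{|S|h_i}+w=c\,A\sum_{i\in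 S}g_i+w,$$ where $w\sim\mathcal N(0,vI_d)$, $v\ge0$, is independent channel noise ($v=0$ means that there is none). Two families of local models are neighbouring if they differ in exactly one client's model. The algorithm is $(\varepsilon',\delta')$-DP (with $\varepsilon'>0$ and $\delta'\in[0,1)$) if $\Pr(z\in R)\le e^{\varepsilon'}\Pr(z'\in R)+\delta'$ for all neighbouring families, all queries and all measurable $R\subseteq\mathbb R^d$, where $z$ and $z'$ are the signals received under the two families. Theorem. For every $\varepsilon'>0$, Algorithm 1 is $(\varepsilon',\delta')$-DP, where $$\delta'=\frac{p}{1-(1-p)^n}\left(\Phi\Big(\frac{1}{\sqrt2\,\sigma}-\frac{\varepsilon\sigma}{\sqrt2}\Big)-e^{\varepsilon}\,\Phi\Big(-\frac{1}{\sqrt2\,\sigma}-\frac{\varepsilon\sigma}{\sqrt2}\Big)\right),\qquad \varepsilon=\log\Big(1+\frac{1-(1-p)^n}{p}\,(e^{\varepsilon'}-1)\Big),$$ and $\Phi$ is the standard normal distribution function. -/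

import Mathlib

open MeasureTheory ProbabilityTheory

noncomputable section

/-- The three ways in which a client turns its class scores into the vector it contributes. -/
inductive FusionMethod where
  | beliefAveraging
  | weightedBeliefAveraging
  | majorityVoting

/-- Mean centering: subtract from every entry the average of all the entries. -/
def meanCenter {k : ℕ} (v : Fin k → ℝ) : Fin k → ℝ :=
  fun j => v j - (∑ i, v i) / k

/-- `f : ℝ^l → ℝ^k` is a possible local model for the given fusion method. The class scores `r x`
are nonnegative and sum to one; the per-class weights `w` are nonnegative and sum to one; `c x` is a
class with the largest score (ties may be broken in any way). -/
def IsLocalModel {l k : ℕ} : FusionMethod → ((Fin l → ℝ) → (Fin k → ℝ)) → Prop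
  | .beliefAveraging, f =>
      ∃ r : (Fin l → ℝ) → (Fin k → ℝ), (∀ x, r x ∈ stdSimplex ℝ (Fin k)) ∧
        ∀ x, f x = meanCenter (r x)
  | .weightedBeliefAveraging, f =>
      ∃ r : (Fin l → ℝ) → (Fin k → ℝ), (∀ x, r x ∈ stdSimplex ℝ (Fin k)) ∧
        ∃ w ∈ stdSimplex ℝ (Fin k), ∀ x, f x = meanCenter (fun j => w j * r x j)
  | .majorityVoting, f =>
      ∃ r : (Fin l → ℝ) → (Fin k → ℝ), (∀ x, r x ∈ stdSimplex ℝ (Fin k)) ∧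
        ∃ c : (Fin l → ℝ) → Fin k, (∀ x j, r x j ≤ r x (c x)) ∧
          ∀ x, f x = meanCenter (Pi.single (c x) 1)

/-- All possible families of local models of the `n` clients. -/
def modelFamilies (n l k : ℕ) (method : FusionMethod) :
    Set (Fin n → (Fin l → ℝ) → (Fin k → ℝ)) :=
  {L | ∀ i, IsLocalModel method (L i)}

/-- Two families of local models are neighbouring if they differ in exactly one client. -/
def Neighbouring {n l k : ℕ} (L L' : Fin n → (Fin l → ℝ) → (Fin k → ℝ)) : Prop :=
  ∃ j, L j ≠ L' j ∧ ∀ i, i ≠ j → L i = L' i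

/-- `(ε, δ)`-differential privacy of a randomized map `M`, given as the law `M X L` of its output on
the queries `X` (client `i` receives `X i`) and the local models `L`, with respect to the
replacement of one local model. -/
def IsDP {n l k d : ℕ} (models : Set (Fin n → (Fin l → ℝ) → (Fin k → ℝ)))
    (M : (Fin n → Fin l → ℝ) → (Fin n → (Fin l → ℝ) → (Fin k → ℝ)) → Measure (Fin d → ℝ))
    (ε δ : ℝ) : Prop :=
  0 < ε ∧ 0 ≤ δ ∧ δ < 1 ∧
    ∀ L ∈ models, ∀ L' ∈ models, Neighbouring L L' →
      ∀ (X : Fin n → Fin l → ℝ) (R : Set (Fin d → ℝ)), MeasurableSet R →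
        M X L R ≤ ENNReal.ofReal (Real.exp ε) * M X L' R + ENNReal.ofReal δ

/-- The isotropic Gaussian law `N(0, v I_m)` on `ℝ^m`. -/
def isotropicGaussian (m : ℕ) (v : ℝ) : Measure (Fin m → ℝ) :=
  Measure.pi fun _ => gaussianReal 0 v.toNNReal

/-- The law of the set of participating clients: every client participates independently with
probability `p`, conditioned on at least one client participating. -/
def participationLaw (n : ℕ) (p : unitInterval) : Measure (Set (Fin n)) :=
  ProbabilityTheory.cond (setBernoulli Set.univ p) {S | S.Nonempty}

/-- The common scaling factor `γ` used when `S` is the set of participating clients. -/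
def scalingFactor {n : ℕ} (c : ℝ) (S : Set (Fin n)) : ℝ := S.ncard * c

open scoped Classical in
/-- The signal transmitted by client `i`, whose noisy prediction is `g`: the vector
`γ A g / (|S| h_i)` if the client participates, and zero otherwise. -/
def transmittedSignal {n k d : ℕ} (c : ℝ) (A : Matrix (Fin d) (Fin k) ℝ) (h : Fin n → ℝ)
    (S : Set (Fin n)) (i : Fin n) (g : Fin k → ℝ) : Fin d → ℝ :=
  if i ∈ S then (scalingFactor c S / (S.ncard * h i)) • A.mulVec g else 0

/-- The signal received over the multiple access channel when the participating set is `S`, the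
client noises are `m` and the channel noise is `w`. -/
def receivedSignal {n l k d : ℕ} (c : ℝ) (A : Matrix (Fin d) (Fin k) ℝ) (h : Fin n → ℝ)
    (X : Fin n → Fin l → ℝ) (L : Fin n → (Fin l → ℝ) → (Fin k → ℝ)) (S : Set (Fin n))
    (m : Fin n → Fin k → ℝ) (w : Fin d → ℝ) : Fin d → ℝ :=
  ∑ i, h i • transmittedSignal c A h S i (L i (X i) + m i) + w

/-- The law of the received signal given the participating set `S`: the client noises are
independent `N(0, (σ²/|S|) I_k)`, and the independent channel noise is `N(0, v I_d)`. -/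
def signalLawGiven {n l k d : ℕ} (σ c : ℝ) (v : NNReal) (A : Matrix (Fin d) (Fin k) ℝ)
    (h : Fin n → ℝ) (X : Fin n → Fin l → ℝ) (L : Fin n → (Fin l → ℝ) → (Fin k → ℝ))
    (S : Set (Fin n)) : Measure (Fin d → ℝ) :=
  ((Measure.pi fun _ : Fin n => isotropicGaussian k (σ ^ 2 / S.ncard)).prod
      (isotropicGaussian d v)).map
    fun ω => receivedSignal c A h X L S ω.1 ω.2

/-- The law of the signal received by the server in private collaborative inference over the air,
with random participation of the clients. -/
def collaborativeInference {n l k d : ℕ} (p : unitInterval) (σ c : ℝ) (v : NNReal)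
    (A : Matrix (Fin d) (Fin k) ℝ) (h : Fin n → ℝ)
    (X : Fin n → Fin l → ℝ) (L : Fin n → (Fin l → ℝ) → (Fin k → ℝ)) : Measure (Fin d → ℝ) :=
  (participationLaw n p).bind (signalLawGiven σ c v A h X L)

/-- The cumulative distribution function `Φ` of the standard normal distribution. -/
def stdNormalCDF (x : ℝ) : ℝ := cdf (gaussianReal 0 1) x

/-- The expression
`δ(ε) = Φ(1/(√2 σ) - εσ/√2) - e^ε Φ(-1/(√2 σ) - εσ/√2)`. -/
def fullParticipationDelta (σ ε : ℝ) : ℝ :=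
  stdNormalCDF (1 / (√2 * σ) - ε * σ / √2) -
    Real.exp ε * stdNormalCDF (-1 / (√2 * σ) - ε * σ / √2)

end

/-!
Given the participating set `S`, the received signal is the image of `∑ i ∈ S, f_i (x_i)` under a
Gaussian mechanism whose total variance `σ²` does not depend on `S`. Replacing the contribution of a
client, removing it, or exchanging it for that of another client moves this sum by at most `√2`,
since mean centering is a contraction and nonnegative vectors with sum at most one are at distance
at most `√2`. By the Neyman–Pearson lemma the corresponding signals are
`(ε, δ(ε))`-indistinguishable.

Now condition on whether the client `j` whose model changes participates; it does so with
probability `η = p / (1 - (1 - p) ^ n)`. If it does not, the signal has the same law for both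
families, but the other participants are then conditioned to be nonempty. This random set is
coupled with the unconditioned one so that it is equal to it or has one more element, which makes
`j` participating comparable with `j` removed or exchanged. Advanced joint convexity combines these
comparisons into the amplified parameters `exp ε' = 1 + η (exp ε - 1)` and `δ' = η δ(ε)`.
-/

section Indistinguishability

variable {Ω Ω' : Type*} [MeasurableSpace Ω] [MeasurableSpace Ω'] {ε δ : ℝ} {μ ν : Measure Ω}

/-- The one-sided `(ε, δ)`-indistinguishability of two laws, the relation that differential privacy
requires between the output laws on neighbouring inputs. -/
def IsIndistinguishable (ε δ : ℝ) (μ ν : Measure Ω) : Prop :=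
  ∀ R, MeasurableSet R → μ R ≤ ENNReal.ofReal (Real.exp ε) * ν R + ENNReal.ofReal δ

theorem isIndistinguishable_iff_real [IsFiniteMeasure μ] [IsFiniteMeasure ν] (hδ : 0 ≤ δ) :
    IsIndistinguishable ε δ μ ν ↔
      ∀ R, MeasurableSet R → μ.real R ≤ Real.exp ε * ν.real R + δ := by
  refine forall₂_congr fun R _ => ?_
  rw [← ofReal_measureReal (μ := μ), ← ofReal_measureReal (μ := ν),
    ← ENNReal.ofReal_mul (Real.exp_pos ε).le, ← ENNReal.ofReal_add (by positivity) hδ,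
    ENNReal.ofReal_le_ofReal_iff (by positivity)]

namespace IsIndistinguishable

theorem map (h : IsIndistinguishable ε δ μ ν) {f : Ω → Ω'} (hf : Measurable f) :
    IsIndistinguishable ε δ (μ.map f) (ν.map f) := fun R hR => by
  rw [Measure.map_apply hf hR, Measure.map_apply hf hR]
  exact h _ (hf hR)

theorem prod_left [SFinite μ] [SFinite ν] (h : IsIndistinguishable ε δ μ ν) (κ : Measure Ω')
    [IsProbabilityMeasure κ] : IsIndistinguishable ε δ (κ.prod μ) (κ.prod ν) := fun R hR => by
  rw [Measure.prod_apply hR, Measure.prod_apply hR]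
  calc ∫⁻ x, μ (Prod.mk x ⁻¹' R) ∂κ
      ≤ ∫⁻ x, (ENNReal.ofReal (Real.exp ε) * ν (Prod.mk x ⁻¹' R) + ENNReal.ofReal δ) ∂κ :=
        lintegral_mono fun x => h _ (measurable_prodMk_left hR)
    _ = ENNReal.ofReal (Real.exp ε) * ∫⁻ x, ν (Prod.mk x ⁻¹' R) ∂κ + ENNReal.ofReal δ := by
        rw [lintegral_add_right _ measurable_const,
          lintegral_const_mul _ (measurable_measure_prodMk_left hR), lintegral_const,
          measure_univ, mul_one]

theorem conv_left [AddMonoid Ω] [MeasurableAdd₂ Ω] [SFinite μ] [SFinite ν]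
    (h : IsIndistinguishable ε δ μ ν) (κ : Measure Ω) [IsProbabilityMeasure κ] :
    IsIndistinguishable ε δ (κ.conv μ) (κ.conv ν) :=
  (h.prod_left κ).map measurable_add

theorem conv_right [AddCommMonoid Ω] [MeasurableAdd₂ Ω] [SFinite μ] [SFinite ν]
    (h : IsIndistinguishable ε δ μ ν) (κ : Measure Ω) [IsProbabilityMeasure κ] :
    IsIndistinguishable ε δ (μ.conv κ) (ν.conv κ) := by
  rw [μ.conv_comm, ν.conv_comm]
  exact h.conv_left κ

end IsIndistinguishable

end Indistinguishability

section GaussianPrivacyProfile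

theorem stdNormalCDF_pos (x : ℝ) : 0 < stdNormalCDF x := by
  rw [stdNormalCDF, cdf_eq_real, measureReal_def]
  refine ENNReal.toReal_pos (fun h => ?_) (measure_ne_top _ _)
  simpa using gaussianReal_absolutelyContinuous' 0 one_ne_zero h

theorem gaussianReal_real_Ici {σ : ℝ} (hσ : 0 < σ) (m t : ℝ) :
    (gaussianReal m (σ ^ 2).toNNReal).real (Set.Ici t) = stdNormalCDF ((m - t) / σ) := by
  have hlaw : gaussianReal m (σ ^ 2).toNNReal =
      (gaussianReal 0 1).map ((m + ·) ∘ (-σ * ·)) := by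
    rw [← Measure.map_map (by fun_prop) (by fun_prop), gaussianReal_map_const_mul,
      gaussianReal_map_const_add]
    congr 1
    · simp
    · ext
      simp [sq_nonneg]
  rw [hlaw, map_measureReal_apply (by fun_prop) measurableSet_Ici, stdNormalCDF, cdf_eq_real]
  congr 1
  ext x
  simp only [Set.mem_preimage, Function.comp_apply, Set.mem_Ici, Set.mem_Iic, le_div_iff₀ hσ]
  constructor <;> intro h <;> linarith

theorem setIntegral_gaussianPDFReal (m : ℝ) {v : NNReal} (hv : v ≠ 0) (B : Set ℝ) :
    ∫ x in B, gaussianPDFReal m v x = (gaussianReal m v).real B := by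
  rw [measureReal_def, gaussianReal_apply_eq_integral m hv,
    ENNReal.toReal_ofReal (integral_nonneg fun x => gaussianPDFReal_nonneg m v x)]

variable {Δ σ : ℝ}

theorem exp_mul_gaussianPDFReal_zero_le_iff (hΔ : 0 < Δ) (hσ : 0 < σ) (ε x : ℝ) :
    Real.exp ε * gaussianPDFReal 0 (σ ^ 2).toNNReal x ≤ gaussianPDFReal Δ (σ ^ 2).toNNReal x ↔
      Δ / 2 + ε * σ ^ 2 / Δ ≤ x := by
  have hnorm : 0 < (√(2 * Real.pi * σ ^ 2))⁻¹ := by positivity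
  have hexponent : -(x - Δ) ^ 2 / (2 * σ ^ 2) - (ε + -(x - 0) ^ 2 / (2 * σ ^ 2)) =
      Δ / σ ^ 2 * (x - (Δ / 2 + ε * σ ^ 2 / Δ)) := by
    field_simp
    ring
  rw [gaussianPDFReal, gaussianPDFReal, Real.coe_toNNReal _ (sq_nonneg σ), mul_left_comm,
    mul_le_mul_iff_right₀ hnorm, ← Real.exp_add, Real.exp_le_exp, ← sub_nonneg, hexponent,
    mul_nonneg_iff_of_pos_left (by positivity), sub_nonneg]

/-- The privacy profile of the Gaussian mechanism with sensitivity `Δ` and standard deviation `σ`: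
the least `δ` for which `N(Δ, σ²)` and `N(0, σ²)` are `(ε, δ)`-indistinguishable. -/
noncomputable def gaussianPrivacyProfile (Δ σ ε : ℝ) : ℝ :=
  stdNormalCDF (Δ / (2 * σ) - ε * σ / Δ) -
    Real.exp ε * stdNormalCDF (-Δ / (2 * σ) - ε * σ / Δ)

theorem gaussianPrivacyProfile_sqrt_two (σ ε : ℝ) :
    gaussianPrivacyProfile √2 σ ε = fullParticipationDelta σ ε := by
  have h : √2 / (2 * σ) = 1 / (√2 * σ) := by
    rw [← div_div, Real.sqrt_div_self, inv_div_left, one_div, mul_comm]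
  rw [gaussianPrivacyProfile, fullParticipationDelta, neg_div, neg_div, h]

-- Neyman–Pearson: the excess `N(Δ, σ²) B - exp ε * N(0, σ²) B` is largest when `B` is the half-line
-- on which the likelihood ratio is at least `exp ε`.
theorem gaussianReal_real_le (hΔ : 0 < Δ) (hσ : 0 < σ) (ε : ℝ) {B : Set ℝ} (hB : MeasurableSet B) :
    (gaussianReal Δ (σ ^ 2).toNNReal).real B ≤
      Real.exp ε * (gaussianReal 0 (σ ^ 2).toNNReal).real B + gaussianPrivacyProfile Δ σ ε := by
  have hv : (σ ^ 2).toNNReal ≠ 0 := by simpa using hσ.ne'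
  let excess : ℝ → ℝ := fun x => gaussianPDFReal Δ (σ ^ 2).toNNReal x -
    Real.exp ε * gaussianPDFReal 0 (σ ^ 2).toNNReal x
  have hint : Integrable excess :=
    (integrable_gaussianPDFReal _ _).sub ((integrable_gaussianPDFReal _ _).const_mul _)
  have hmeas : StronglyMeasurable excess :=
    (stronglyMeasurable_gaussianPDFReal _ _).sub
      ((stronglyMeasurable_gaussianPDFReal _ _).const_mul _)
  have hexcess (C : Set ℝ) : ∫ x in C, excess x = (gaussianReal Δ (σ ^ 2).toNNReal).real C -
      Real.exp ε * (gaussianReal 0 (σ ^ 2).toNNReal).real C := by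
    rw [integral_sub (integrable_gaussianPDFReal _ _).integrableOn
        ((integrable_gaussianPDFReal _ _).const_mul _).integrableOn, integral_const_mul,
      setIntegral_gaussianPDFReal _ hv, setIntegral_gaussianPDFReal _ hv]
  have hregion : {x | 0 ≤ excess x} = Set.Ici (Δ / 2 + ε * σ ^ 2 / Δ) := by
    ext x
    exact sub_nonneg.trans (exp_mul_gaussianPDFReal_zero_le_iff hΔ hσ ε x)
  have hprofile : ∫ x in {x | 0 ≤ excess x}, excess x = gaussianPrivacyProfile Δ σ ε := by
    rw [hregion, hexcess, gaussianReal_real_Ici hσ, gaussianReal_real_Ici hσ,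
      gaussianPrivacyProfile]
    congr 3 <;> (field_simp; ring)
  have hle := setIntegral_le_nonneg hB hmeas hint
  rw [hexcess, hprofile] at hle
  linarith

theorem gaussianPrivacyProfile_nonneg (hΔ : 0 < Δ) (hσ : 0 < σ) (ε : ℝ) :
    0 ≤ gaussianPrivacyProfile Δ σ ε := by
  simpa using gaussianReal_real_le hΔ hσ ε MeasurableSet.empty

theorem gaussianPrivacyProfile_lt_one (Δ σ ε : ℝ) : gaussianPrivacyProfile Δ σ ε < 1 :=
  sub_lt_iff_lt_add.2 <| (cdf_le_one _ _).trans_lt <|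
    lt_add_of_pos_right _ (mul_pos (Real.exp_pos ε) (stdNormalCDF_pos _))

theorem isIndistinguishable_gaussianReal (hΔ : 0 < Δ) (hσ : 0 < σ) (ε : ℝ) :
    IsIndistinguishable ε (gaussianPrivacyProfile Δ σ ε)
      (gaussianReal Δ (σ ^ 2).toNNReal) (gaussianReal 0 (σ ^ 2).toNNReal) :=
  (isIndistinguishable_iff_real (gaussianPrivacyProfile_nonneg hΔ hσ ε)).2 fun _ hB =>
    gaussianReal_real_le hΔ hσ ε hB

end GaussianPrivacyProfile

section IsotropicGaussian

instance (m : ℕ) (v : ℝ) : IsProbabilityMeasure (isotropicGaussian m v) := by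
  unfold isotropicGaussian
  infer_instance

theorem charFunDual_gaussianReal_zero (v : NNReal) (L : StrongDual ℝ ℝ) :
    charFunDual (gaussianReal 0 v) L = Complex.exp ↑(-(v * L 1 ^ 2) / 2 : ℝ) := by
  rw [charFunDual_eq_charFun_map_one, gaussianReal_map_continuousLinearMap, charFun_gaussianReal]
  congr 1
  simp [max_eq_left (sq_nonneg (L 1))]
  ring

variable {k : ℕ} {v : ℝ}

theorem charFunDual_isotropicGaussian (hv : 0 ≤ v) (L : StrongDual ℝ (Fin k → ℝ)) :
    charFunDual (isotropicGaussian k v) L =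
      Complex.exp ↑(-(v * ∑ i, L (Pi.single i 1) ^ 2) / 2 : ℝ) := by
  simp_rw [isotropicGaussian, charFunDual_pi, charFunDual_gaussianReal_zero]
  rw [← Complex.exp_sum, ← Complex.ofReal_sum, Real.coe_toNNReal v hv, Finset.mul_sum,
    ← Finset.sum_neg_distrib, Finset.sum_div]
  rfl

theorem map_finsetSum_isotropicGaussian {ι : Type*} [Fintype ι] (hv : 0 ≤ v) {S : Finset ι}
    (hS : S.Nonempty) :
    (Measure.pi fun _ : ι => isotropicGaussian k (v / S.card)).map (fun m => ∑ i ∈ S, m i) =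
      isotropicGaussian k v := by
  have hindep : iIndepFun (fun i (m : ι → Fin k → ℝ) => m i)
      (Measure.pi fun _ : ι => isotropicGaussian k (v / S.card)) :=
    iIndepFun_pi (X := fun _ => id) fun _ => aemeasurable_id
  have : IsProbabilityMeasure ((Measure.pi fun _ : ι => isotropicGaussian k (v / S.card)).map
      fun m => ∑ i ∈ S, m i) := Measure.isProbabilityMeasure_map (by fun_prop)
  refine Measure.ext_of_charFunDual (funext fun L => ?_)
  rw [(hindep.restrict _).charFunDual_map_fun_finsetSum_eq_prod fun i _ =>
    (measurable_pi_apply i).aemeasurable,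
    Finset.prod_apply]
  simp only [(measurePreserving_eval (fun _ : ι => isotropicGaussian k (v / S.card)) _).map_eq,
    charFunDual_isotropicGaussian (div_nonneg hv S.card.cast_nonneg),
    charFunDual_isotropicGaussian hv, Finset.prod_const, ← Complex.exp_nat_mul]
  congr 1
  have hcard : (S.card : ℂ) ≠ 0 := by exact_mod_cast hS.card_pos.ne'
  push_cast
  field_simp

theorem charFunDual_map_ofLp_multivariateGaussian {C : Matrix (Fin k) (Fin k) ℝ}
    (hC : C.PosSemidef) (L : StrongDual ℝ (Fin k → ℝ)) :
    charFunDual ((multivariateGaussian 0 C).map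
        (PiLp.continuousLinearEquiv 2 ℝ fun _ : Fin k => ℝ).toContinuousLinearMap) L =
      Complex.exp ↑(-((fun i => L (Pi.single i 1)) ⬝ᵥ C.mulVec fun i => L (Pi.single i 1)) / 2 :
        ℝ) := by
  let ofLp := (PiLp.continuousLinearEquiv 2 ℝ fun _ : Fin k => ℝ).toContinuousLinearMap
  have hcoord : ((InnerProductSpace.toDual ℝ _).symm (L.comp ofLp)).ofLp =
      fun i => L (Pi.single i 1) := by
    ext i
    have hdual := InnerProductSpace.toDual_symm_apply (𝕜 := ℝ) (y := L.comp ofLp)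
      (x := EuclideanSpace.single i 1)
    rw [EuclideanSpace.inner_single_right, one_mul, conj_trivial] at hdual
    exact hdual.trans (congrArg L (PiLp.ofLp_single 2 i 1))
  rw [charFunDual_map, ← charFun_toDual_symm_eq_charFunDual, charFun_multivariateGaussian hC,
    hcoord]
  simp [neg_div]

-- `κ` is the Gaussian with covariance `v • (1 - a aᵀ)`, positive semidefinite by Cauchy–Schwarz.
theorem exists_conv_map_smul_eq_isotropicGaussian (hv : 0 ≤ v) {a : Fin k → ℝ}
    (ha : ∑ i, a i ^ 2 ≤ 1) :
    ∃ κ : Measure (Fin k → ℝ), IsProbabilityMeasure κ ∧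
      κ.conv ((gaussianReal 0 v.toNNReal).map (· • a)) = isotropicGaussian k v := by
  let C : Matrix (Fin k) (Fin k) ℝ := v • (1 - Matrix.vecMulVec a a)
  have hform (x : Fin k → ℝ) : x ⬝ᵥ C.mulVec x = v * (∑ i, x i ^ 2 - (∑ i, x i * a i) ^ 2) := by
    simp only [C, Matrix.smul_mulVec, Matrix.sub_mulVec, Matrix.one_mulVec,
      Matrix.vecMulVec_mulVec, dotProduct_smul, dotProduct_sub, smul_eq_mul,
      MulOpposite.smul_eq_mul_unop, MulOpposite.unop_op]
    rw [dotProduct_comm a x]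
    simp only [dotProduct, sq]
  have hC : C.PosSemidef := by
    refine .of_dotProduct_mulVec_nonneg ?_ fun x => ?_
    · ext i j
      simp [C, Matrix.vecMulVec_apply, Matrix.one_apply, mul_comm, eq_comm]
    · rw [star_trivial, hform]
      have hcs := Finset.sum_mul_sq_le_sq_mul_sq Finset.univ x a
      exact mul_nonneg hv (sub_nonneg.2 (hcs.trans (mul_le_of_le_one_right (by positivity) ha)))
  let line : ℝ →L[ℝ] Fin k → ℝ := (ContinuousLinearMap.id ℝ ℝ).smulRight a
  have : IsProbabilityMeasure ((gaussianReal 0 v.toNNReal).map line) :=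
    Measure.isProbabilityMeasure_map (by fun_prop)
  have hκ : IsProbabilityMeasure ((multivariateGaussian 0 C).map
      (PiLp.continuousLinearEquiv 2 ℝ fun _ : Fin k => ℝ).toContinuousLinearMap) :=
    Measure.isProbabilityMeasure_map (by fun_prop)
  refine ⟨_, hκ, Measure.ext_of_charFunDual (funext fun L => ?_)⟩
  change charFunDual (Measure.conv _ ((gaussianReal 0 v.toNNReal).map line)) L = _
  have hLa : L (line 1) = ∑ i, L (Pi.single i 1) * a i := by
    simp only [line, ContinuousLinearMap.smulRight_apply, ContinuousLinearMap.id_apply, one_smul]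
    conv_lhs => rw [pi_eq_sum_univ' a, map_sum]
    simp [mul_comm]
  rw [charFunDual_conv, charFunDual_map_ofLp_multivariateGaussian hC, charFunDual_map,
    charFunDual_gaussianReal_zero,
    charFunDual_isotropicGaussian hv, hform, Real.coe_toNNReal v hv, ← Complex.exp_add,
    ContinuousLinearMap.comp_apply, hLa, ← Complex.ofReal_add]
  congr 2
  ring

theorem conv_map_const_add {M : Type*} [AddCommMonoid M] [MeasurableSpace M] [MeasurableAdd₂ M]
    (μ ν : Measure M) [SFinite μ] [SFinite ν] (x : M) :
    μ.conv (ν.map (x + ·)) = (μ.conv ν).map (x + ·) := by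
  rw [← Measure.dirac_conv, ← Measure.dirac_conv, ← Measure.conv_assoc, μ.conv_comm,
    Measure.conv_assoc]

-- Only the noise component along `x - y` distinguishes the two laws; the orthogonal part is common.
theorem isIndistinguishable_map_add_isotropicGaussian {Δ σ : ℝ} (hΔ : 0 < Δ) (hσ : 0 < σ) (ε : ℝ)
    {x y : Fin k → ℝ} (hxy : ∑ i, (x i - y i) ^ 2 ≤ Δ ^ 2) :
    IsIndistinguishable ε (gaussianPrivacyProfile Δ σ ε)
      ((isotropicGaussian k (σ ^ 2)).map (x + ·)) ((isotropicGaussian k (σ ^ 2)).map (y + ·)) := by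
  let a : Fin k → ℝ := Δ⁻¹ • (x - y)
  have ha : ∑ i, a i ^ 2 ≤ 1 := by
    simp only [a, Pi.smul_apply, Pi.sub_apply, smul_eq_mul, mul_pow, ← Finset.mul_sum]
    rw [inv_pow, inv_mul_le_one₀ (by positivity)]
    exact hxy
  obtain ⟨κ, hκ, hsplit⟩ := exists_conv_map_smul_eq_isotropicGaussian (sq_nonneg σ) ha
  let line (m : ℝ) : Measure (Fin k → ℝ) := (gaussianReal m (σ ^ 2).toNNReal).map (· • a)
  have hline (m : ℝ) : line m = (line 0).map (m • a + ·) := by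
    have hm : gaussianReal m (σ ^ 2).toNNReal = (gaussianReal 0 (σ ^ 2).toNNReal).map (m + ·) := by
      rw [gaussianReal_map_const_add, zero_add]
    simp only [line]
    rw [hm, Measure.map_map (by fun_prop) (by fun_prop),
      Measure.map_map (by fun_prop) (by fun_prop)]
    simp [Function.comp_def, add_smul]
  have hlaw (m : ℝ) :
      (isotropicGaussian k (σ ^ 2)).map (y + m • a + ·) = (κ.conv (line m)).map (y + ·) := by
    rw [hline, conv_map_const_add, hsplit, Measure.map_map (by fun_prop) (by fun_prop)]
    simp [Function.comp_def, add_assoc]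
  have hline_indist : IsIndistinguishable ε (gaussianPrivacyProfile Δ σ ε) (line Δ) (line 0) :=
    (isIndistinguishable_gaussianReal hΔ hσ ε).map (by fun_prop)
  have hx : x = y + Δ • a := by simp [a, hΔ.ne']
  have hy : y = y + (0 : ℝ) • a := by simp
  rw [hx, hlaw]
  nth_rw 2 [hy]
  rw [hlaw]
  exact (hline_indist.conv_left κ).map (by fun_prop)

end IsotropicGaussian

section RandomSubset

theorem prod_one_sub_mem_Icc {ι : Type*} (p : ι → unitInterval) (M : Finset ι) :
    ∏ i ∈ M, (1 - p i : ℝ) ∈ Set.Icc (0 : ℝ) 1 :=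
  ⟨Finset.prod_nonneg fun i _ => sub_nonneg.2 (p i).2.2,
    Finset.prod_le_one (fun i _ => sub_nonneg.2 (p i).2.2) fun i _ => sub_le_self _ (p i).2.1⟩

variable {ι : Type*} [DecidableEq ι] {p : ι → unitInterval} {M : Finset ι} {g h : Finset ι → ℝ}

/-- The expectation of `g T` when the random subset `T` of `M` contains each `i ∈ M` independently
with probability `p i`. -/
noncomputable def subsetMean (p : ι → unitInterval) (M : Finset ι) (g : Finset ι → ℝ) : ℝ :=
  ∑ T ∈ M.powerset, ((∏ i ∈ T, (p i : ℝ)) * ∏ i ∈ M \ T, (1 - p i : ℝ)) * g T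

/-- The expectation of `g T` for the random subset `T` of `subsetMean`, conditioned on `T` being
nonempty. It is `0` when `T` is almost surely empty, by the convention `x / 0 = 0`. -/
noncomputable def nonemptySubsetMean (p : ι → unitInterval) (M : Finset ι) (g : Finset ι → ℝ) : ℝ :=
  subsetMean p M (fun T => if T.Nonempty then g T else 0) / (1 - ∏ i ∈ M, (1 - p i : ℝ))

theorem subsetMean_insert {j : ι} (hj : j ∉ M) :
    subsetMean p (insert j M) g =
      (1 - p j) * subsetMean p M g + p j * subsetMean p M fun T => g (insert j T) := by
  rw [subsetMean, Finset.sum_powerset_insert hj, subsetMean, subsetMean, Finset.mul_sum,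
    Finset.mul_sum]
  congr 1 <;> refine Finset.sum_congr rfl fun T hT => ?_ <;>
    have hjT : j ∉ T := fun h => hj (Finset.mem_powerset.1 hT h)
  · rw [Finset.insert_sdiff_of_notMem _ hjT,
      Finset.prod_insert fun h => hj (Finset.mem_sdiff.1 h).1]
    ring
  · rw [Finset.insert_sdiff_insert, Finset.sdiff_insert_of_notMem hj, Finset.prod_insert hjT]
    ring

theorem subsetMean_mono (hgh : ∀ T ⊆ M, g T ≤ h T) : subsetMean p M g ≤ subsetMean p M h :=
  Finset.sum_le_sum fun T hT => mul_le_mul_of_nonneg_left (hgh T (Finset.mem_powerset.1 hT)) <|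
    mul_nonneg (Finset.prod_nonneg fun i _ => (p i).2.1) (prod_one_sub_mem_Icc p _).1

theorem subsetMean_congr (hgh : ∀ T ⊆ M, g T = h T) : subsetMean p M g = subsetMean p M h :=
  Finset.sum_congr rfl fun T hT => by rw [hgh T (Finset.mem_powerset.1 hT)]

theorem subsetMean_add :
    subsetMean p M (fun T => g T + h T) = subsetMean p M g + subsetMean p M h := by
  simp only [subsetMean, mul_add, Finset.sum_add_distrib]

theorem subsetMean_const_mul (a : ℝ) :
    subsetMean p M (fun T => a * g T) = a * subsetMean p M g := by
  simp only [subsetMean, Finset.mul_sum, mul_left_comm a]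

theorem subsetMean_const (b : ℝ) : subsetMean p M (fun _ => b) = b := by
  rw [subsetMean, ← Finset.sum_mul, ← Finset.prod_add]
  simp

theorem subsetMean_nonempty_const (b : ℝ) :
    subsetMean p M (fun T => if T.Nonempty then b else 0) = (1 - ∏ i ∈ M, (1 - p i : ℝ)) * b := by
  induction M using Finset.induction_on with
  | empty => simp [subsetMean]
  | insert j M hj ih =>
    simp only [subsetMean_insert hj, Finset.insert_nonempty, if_true, subsetMean_const, ih,
      Finset.prod_insert hj]
    ring

-- A random subset and a random nonempty subset can be coupled so that they are equal or the latter
-- has one more element; the induction on `M` averages over such a coupling.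
theorem one_sub_prod_mul_subsetMean_le (hself : ∀ T ⊆ M, T.Nonempty → g T ≤ h T)
    (hinsert : ∀ T ⊆ M, ∀ i ∈ M \ T, g T ≤ h (insert i T)) :
    (1 - ∏ i ∈ M, (1 - p i : ℝ)) * subsetMean p M g ≤
      subsetMean p M fun T => if T.Nonempty then h T else 0 := by
  induction M using Finset.induction_on with
  | empty => simp [subsetMean]
  | insert j M hj ih =>
    have hsub {T} (hT : T ⊆ M) : T ⊆ insert j M := hT.trans (Finset.subset_insert j M)
    have hfresh {T} (hT : T ⊆ M) : j ∈ insert j M \ T := by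
      simpa using fun h => hj (hT h)
    simp only [subsetMean_insert hj, Finset.prod_insert hj, Finset.insert_nonempty, if_true]
    set P := ∏ i ∈ M, (1 - p i : ℝ)
    set x := subsetMean p M g
    set y := subsetMean p M fun T => g (insert j T)
    set z := subsetMean p M fun T => h (insert j T)
    have hxz : x ≤ z := subsetMean_mono fun T hT => hinsert T (hsub hT) j (hfresh hT)
    have hyz : y ≤ z := subsetMean_mono fun T hT =>
      hself _ (Finset.insert_subset_insert j hT) (Finset.insert_nonempty j T)
    have hr : 0 ≤ (1 - p j : ℝ) := sub_nonneg.2 (p j).2.2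
    obtain ⟨hrP, hrP_le⟩ : (1 - p j) * P ∈ Set.Icc (0 : ℝ) 1 :=
      Finset.prod_insert (f := fun i => (1 - p i : ℝ)) hj ▸ prod_one_sub_mem_Icc p (insert j M)
    have hconvex : (1 - p j) * P * x + (1 - (1 - p j) * P) * y ≤ z := by
      nlinarith [mul_le_mul_of_nonneg_left hxz hrP,
        mul_le_mul_of_nonneg_left hyz (sub_nonneg.2 hrP_le)]
    have ih' := ih (fun T hT => hself T (hsub hT)) fun T hT i hi =>
      hinsert T (hsub hT) i (Finset.sdiff_subset_sdiff (Finset.subset_insert j M) subset_rfl hi)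
    calc (1 - (1 - p j) * P) * ((1 - p j) * x + p j * y)
        = (1 - p j) * ((1 - P) * x) +
            p j * ((1 - p j) * P * x + (1 - (1 - p j) * P) * y) := by ring
      _ ≤ _ := add_le_add (mul_le_mul_of_nonneg_left ih' hr)
          (mul_le_mul_of_nonneg_left hconvex (p j).2.1)

end RandomSubset

section Amplification

-- Advanced joint convexity of the hockey-stick divergence: `X` is the contribution of the inputs
-- that do not involve the changed record, and `a`, `a'` are the conditional probabilities when the
-- record is involved.
theorem add_mul_le_of_advanced_joint_convexity {η e δ X a a' : ℝ} (hη : 0 ≤ η) (he : 1 ≤ e)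
    (haa' : a ≤ e * a' + δ) (haX : (1 - η) * a ≤ e * X + (1 - η) * δ) :
    X + η * a ≤ (1 + η * (e - 1)) * (X + η * a') + η * δ := by
  have hr : 0 ≤ 1 + η * (e - 1) := by nlinarith
  have key : e * a ≤ (e - 1) * (e * X) + (1 + η * (e - 1)) * (e * a') + e * δ := by
    linarith [mul_le_mul_of_nonneg_left haa' hr, mul_le_mul_of_nonneg_left haX (sub_nonneg.2 he)]
  refine le_of_mul_le_mul_left ?_ (zero_lt_one.trans_le he)
  linarith [mul_le_mul_of_nonneg_left key hη]

theorem nonneg_and_exp_eq_of_eq_log {η ε ε' : ℝ} (hη : 0 < η) (hε' : 0 ≤ ε')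
    (hε : ε = Real.log (1 + η⁻¹ * (Real.exp ε' - 1))) :
    0 ≤ ε ∧ Real.exp ε' = 1 + η * (Real.exp ε - 1) := by
  have hpos : 0 ≤ η⁻¹ * (Real.exp ε' - 1) :=
    mul_nonneg (inv_nonneg.2 hη.le) (sub_nonneg.2 (Real.one_le_exp hε'))
  refine ⟨hε ▸ Real.log_nonneg (le_add_of_nonneg_right hpos), ?_⟩
  rw [hε, Real.exp_log (by linarith), add_sub_cancel_left, mul_inv_cancel_left₀ hη.ne',
    add_sub_cancel]

variable {ι : Type*} [DecidableEq ι] {p : ι → unitInterval} {M : Finset ι} {j : ι}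

theorem nonemptySubsetMean_insert (hj : j ∉ M) (F : Finset ι → ℝ) :
    nonemptySubsetMean p (insert j M) F =
      (1 - p j) / (1 - ∏ i ∈ insert j M, (1 - p i : ℝ)) *
          subsetMean p M (fun T => if T.Nonempty then F T else 0) +
        p j / (1 - ∏ i ∈ insert j M, (1 - p i : ℝ)) * subsetMean p M fun T => F (insert j T) := by
  simp only [nonemptySubsetMean, subsetMean_insert hj, Finset.insert_nonempty, if_true]
  ring

theorem one_sub_prod_mul_subsetMean_le_const_mul_add {e δ : ℝ} {G H : Finset ι → ℝ}
    (hself : ∀ T ⊆ M, T.Nonempty → H T ≤ e * G T + δ)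
    (hinsert : ∀ T ⊆ M, ∀ i ∈ M \ T, H T ≤ e * G (insert i T) + δ) :
    (1 - ∏ i ∈ M, (1 - p i : ℝ)) * subsetMean p M H ≤
      e * subsetMean p M (fun T => if T.Nonempty then G T else 0) +
        (1 - ∏ i ∈ M, (1 - p i : ℝ)) * δ := by
  refine (one_sub_prod_mul_subsetMean_le hself hinsert).trans_eq ?_
  rw [← subsetMean_nonempty_const, ← subsetMean_const_mul, ← subsetMean_add]
  exact subsetMean_congr fun T _ => by split_ifs <;> simp

theorem nonemptySubsetMean_insert_le (hj : j ∉ M) (hpj : 0 < p j) {e δ η : ℝ} (he : 1 ≤ e)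
    (hη : η = p j / (1 - ∏ i ∈ insert j M, (1 - p i : ℝ))) {G G' : Finset ι → ℝ}
    (hagree : ∀ T ⊆ M, G' T = G T)
    (hreplace : ∀ T ⊆ M, G (insert j T) ≤ e * G' (insert j T) + δ)
    (hremove : ∀ T ⊆ M, T.Nonempty → G (insert j T) ≤ e * G T + δ)
    (hexchange : ∀ T ⊆ M, ∀ i ∈ M \ T, G (insert j T) ≤ e * G (insert i T) + δ) :
    nonemptySubsetMean p (insert j M) G ≤
      (1 + η * (e - 1)) * nonemptySubsetMean p (insert j M) G' + η * δ := by
  set D := 1 - ∏ i ∈ insert j M, (1 - p i : ℝ) with hDdef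
  set P := ∏ i ∈ M, (1 - p i : ℝ)
  have hDP : D = 1 - (1 - p j) * P := by rw [hDdef, Finset.prod_insert hj]
  have hP : P ≤ 1 := (prod_one_sub_mem_Icc p M).2
  have hr : 0 ≤ (1 - p j : ℝ) := sub_nonneg.2 (p j).2.2
  have hpj' : (0 : ℝ) < p j := hpj
  have hD : 0 < D := by nlinarith [mul_nonneg hr (sub_nonneg.2 hP)]
  have hη1 : 1 - η = (1 - p j) / D * (1 - P) := by
    rw [hη, div_mul_eq_mul_div, eq_div_iff hD.ne', sub_mul, div_mul_cancel₀ _ hD.ne', hDP]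
    ring
  have hwith : subsetMean p M (fun T => G (insert j T)) ≤
      e * subsetMean p M (fun T => G' (insert j T)) + δ :=
    (subsetMean_mono hreplace).trans_eq <| by
      rw [subsetMean_add, subsetMean_const_mul, subsetMean_const]
  have hrest : subsetMean p M (fun T => if T.Nonempty then G' T else 0) =
      subsetMean p M fun T => if T.Nonempty then G T else 0 :=
    subsetMean_congr fun T hT => by rw [hagree T hT]
  have hcouple := one_sub_prod_mul_subsetMean_le_const_mul_add (p := p) hremove hexchange
  rw [nonemptySubsetMean_insert hj, nonemptySubsetMean_insert hj, hrest, ← hDdef, ← hη]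
  refine add_mul_le_of_advanced_joint_convexity (hη ▸ by positivity) he hwith ?_
  rw [hη1]
  linarith [mul_le_mul_of_nonneg_left hcouple (div_nonneg hr hD.le)]

end Amplification

section ReceivedSignal

variable {n l k d : ℕ} {σ c : ℝ} {v : NNReal} {A : Matrix (Fin d) (Fin k) ℝ} {h : Fin n → ℝ}
  {L : Fin n → (Fin l → ℝ) → (Fin k → ℝ)} {S : Finset (Fin n)}

/-- The law of `c A (x + m) + w` for independent noises `m ∼ N(0, σ² I_k)` and `w ∼ N(0, v I_d)`:
the received signal when `x` is the sum of the participating predictions. -/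
noncomputable def projectedGaussianLaw (σ c : ℝ) (v : NNReal) (A : Matrix (Fin d) (Fin k) ℝ)
    (x : Fin k → ℝ) : Measure (Fin d → ℝ) :=
  (((isotropicGaussian k (σ ^ 2)).map (x + ·)).map fun y => c • A.mulVec y).conv
    (isotropicGaussian d v)

@[fun_prop]
theorem measurable_smul_mulVec (c : ℝ) (A : Matrix (Fin d) (Fin k) ℝ) :
    Measurable fun y : Fin k → ℝ => c • A.mulVec y :=
  ((continuous_const.matrix_mulVec continuous_id).const_smul c).measurable

instance (x : Fin k → ℝ) : IsFiniteMeasure (projectedGaussianLaw σ c v A x) := by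
  unfold projectedGaussianLaw
  infer_instance

theorem isIndistinguishable_projectedGaussianLaw (c : ℝ) (v : NNReal)
    (A : Matrix (Fin d) (Fin k) ℝ) {Δ : ℝ} (hΔ : 0 < Δ) (hσ : 0 < σ) (ε : ℝ) {x y : Fin k → ℝ}
    (hxy : ∑ i, (x i - y i) ^ 2 ≤ Δ ^ 2) :
    IsIndistinguishable ε (gaussianPrivacyProfile Δ σ ε)
      (projectedGaussianLaw σ c v A x) (projectedGaussianLaw σ c v A y) :=
  ((isIndistinguishable_map_add_isotropicGaussian hΔ hσ ε hxy).map
    (measurable_smul_mulVec c A)).conv_right _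

theorem receivedSignal_coe_finset (hh : ∀ i, h i ≠ 0) (X : Fin n → Fin l → ℝ)
    (hS : S.Nonempty) (m : Fin n → Fin k → ℝ) (w : Fin d → ℝ) :
    receivedSignal c A h X L S m w = c • A.mulVec (∑ i ∈ S, L i (X i) + ∑ i ∈ S, m i) + w := by
  have hcard : (S.card : ℝ) ≠ 0 := Nat.cast_ne_zero.2 hS.card_ne_zero
  have hgain (i : Fin n) : h i * (S.card * c / (S.card * h i)) = c := by
    have := hh i
    field_simp
  simp only [receivedSignal, transmittedSignal, scalingFactor, Finset.mem_coe,
    Set.ncard_coe_finset, smul_ite, smul_zero, smul_smul, hgain]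
  rw [Finset.sum_ite_mem, Finset.univ_inter, ← Finset.smul_sum, ← Finset.sum_add_distrib,
    ← Matrix.mulVec_sum]

theorem signalLawGiven_coe_finset (hh : ∀ i, h i ≠ 0) (X : Fin n → Fin l → ℝ)
    (hS : S.Nonempty) :
    signalLawGiven σ c v A h X L S = projectedGaussianLaw σ c v A (∑ i ∈ S, L i (X i)) := by
  rw [signalLawGiven, projectedGaussianLaw, Set.ncard_coe_finset,
    ← map_finsetSum_isotropicGaussian (sq_nonneg σ) hS, Measure.map_map (by fun_prop) (by fun_prop),
    Measure.map_map (by fun_prop) (by fun_prop), Measure.conv,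
    ← Measure.map_id (μ := isotropicGaussian d v),
    Measure.map_prod_map _ _ (by fun_prop) measurable_id,
    Measure.map_map (by fun_prop) (by fun_prop), Measure.map_id]
  congr 1
  ext ω : 1
  exact receivedSignal_coe_finset hh X hS ω.1 ω.2

end ReceivedSignal

section CollaborativeInference

variable {n l k d : ℕ}

theorem setBernoulli_univ_real_nonempty (ι : Type*) [Fintype ι] (p : unitInterval) :
    (setBernoulli (Set.univ : Set ι) p).real {S | S.Nonempty} =
      1 - (1 - p : ℝ) ^ Fintype.card ι := by
  have hcompl : {S : Set ι | S.Nonempty} = {∅}ᶜ := by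
    ext S
    exact Set.nonempty_iff_ne_empty
  rw [hcompl, probReal_compl_eq_one_sub .of_discrete,
    setBernoulli_real_singleton p (Set.empty_subset _) Set.finite_univ]
  simp [Set.ncard_univ]

instance (p : unitInterval) : IsFiniteMeasure (participationLaw n p) := by
  unfold participationLaw
  infer_instance

theorem participationLaw_real_singleton (p : unitInterval) (S : Finset (Fin n)) :
    (participationLaw n p).real {(S : Set (Fin n))} =
      if S.Nonempty then p ^ S.card * (1 - p : ℝ) ^ (n - S.card) / (1 - (1 - p : ℝ) ^ n)
      else 0 := by
  rw [participationLaw, measureReal_def, cond_apply .of_discrete, ENNReal.toReal_mul,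
    ENNReal.toReal_inv, ← measureReal_def, ← measureReal_def, setBernoulli_univ_real_nonempty,
    Fintype.card_fin]
  split_ifs with hS
  · have hsingleton : {S : Set (Fin n) | S.Nonempty} ∩ {(S : Set (Fin n))} = {(S : Set (Fin n))} :=
      Set.inter_eq_right.2 (Set.singleton_subset_iff.2 hS)
    rw [hsingleton, setBernoulli_real_singleton p (Set.subset_univ _) Set.finite_univ,
      Set.ncard_sdiff (Set.subset_univ _), Set.ncard_univ, Set.ncard_coe_finset, Nat.card_fin,
      inv_mul_eq_div]
  · rw [Set.inter_singleton_eq_empty.2 (by simpa using hS)]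
    simp

theorem collaborativeInference_apply (p : unitInterval) (σ c : ℝ) (v : NNReal)
    (A : Matrix (Fin d) (Fin k) ℝ) {h : Fin n → ℝ} (hh : ∀ i, h i ≠ 0) (X : Fin n → Fin l → ℝ)
    (L : Fin n → (Fin l → ℝ) → (Fin k → ℝ)) {R : Set (Fin d → ℝ)} (hR : MeasurableSet R) :
    collaborativeInference p σ c v A h X L R =
      ENNReal.ofReal (nonemptySubsetMean (fun _ => p) Finset.univ fun S =>
        (projectedGaussianLaw σ c v A (∑ i ∈ S, L i (X i))).real R) := by
  have hfinite (S : Set (Fin n)) : IsFiniteMeasure (signalLawGiven σ c v A h X L S) := by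
    unfold signalLawGiven
    infer_instance
  have hmean : (nonemptySubsetMean (fun _ => p) Finset.univ fun S =>
      (projectedGaussianLaw σ c v A (∑ i ∈ S, L i (X i))).real R) =
      ∑ S : Finset (Fin n), (signalLawGiven σ c v A h X L S).real R *
        (participationLaw n p).real {(S : Set (Fin n))} := by
    rw [nonemptySubsetMean, subsetMean, Finset.powerset_univ, Finset.sum_div]
    refine Finset.sum_congr rfl fun S _ => ?_
    rw [participationLaw_real_singleton]
    split_ifs with hS
    · rw [signalLawGiven_coe_finset hh X hS]
      simp only [Finset.prod_const, Finset.card_univ_sdiff, Finset.card_univ, Fintype.card_fin]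
      ring
    · simp
  rw [hmean, ENNReal.ofReal_sum_of_nonneg fun S _ => by positivity, collaborativeInference,
    Measure.bind_apply hR Measurable.of_discrete.aemeasurable, lintegral_fintype,
    ← Fintype.finsetEquivSet.sum_comp]
  refine Finset.sum_congr rfl fun S _ => ?_
  rw [ENNReal.ofReal_mul measureReal_nonneg, ofReal_measureReal, ofReal_measureReal,
    Fintype.coe_finsetEquivSet]

theorem le_one_sub_one_sub_pow (hn : 0 < n) (p : unitInterval) : p ≤ 1 - (1 - p : ℝ) ^ n :=
  le_sub_comm.1 (pow_le_of_le_one (sub_nonneg.2 p.2.2) (sub_le_self _ p.2.1) hn.ne')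

theorem isIndistinguishable_collaborativeInference {p : unitInterval} (hp : 0 < p) {σ : ℝ}
    (hσ : 0 < σ) {c : ℝ} {v : NNReal} {A : Matrix (Fin d) (Fin k) ℝ} {h : Fin n → ℝ}
    (hh : ∀ i, h i ≠ 0) (X : Fin n → Fin l → ℝ) {L L' : Fin n → (Fin l → ℝ) → (Fin k → ℝ)}
    {j : Fin n} {Δ ε ε' : ℝ} (hΔ : 0 < Δ) (hε : 0 ≤ ε)
    (hε' : Real.exp ε' = 1 + p / (1 - (1 - p : ℝ) ^ n) * (Real.exp ε - 1))
    (hagree : ∀ i, i ≠ j → L i = L' i)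
    (hreplace : ∑ r, (L j (X j) r - L' j (X j) r) ^ 2 ≤ Δ ^ 2)
    (hremove : ∑ r, L j (X j) r ^ 2 ≤ Δ ^ 2)
    (hexchange : ∀ i, i ≠ j → ∑ r, (L j (X j) r - L i (X i) r) ^ 2 ≤ Δ ^ 2) :
    IsIndistinguishable ε' (p / (1 - (1 - p : ℝ) ^ n) * gaussianPrivacyProfile Δ σ ε)
      (collaborativeInference p σ c v A h X L) (collaborativeInference p σ c v A h X L') := by
  intro R hR
  let M : Finset (Fin n) := Finset.univ.erase j
  have hjM {T} (hT : T ⊆ M) : j ∉ T := fun hj => Finset.notMem_erase j _ (hT hj)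
  have hMuniv : insert j M = Finset.univ := Finset.insert_erase (Finset.mem_univ j)
  have hsum (T) (hT : T ⊆ M) : ∑ i ∈ T, L' i (X i) = ∑ i ∈ T, L i (X i) :=
    Finset.sum_congr rfl fun i hi => by rw [hagree i (Finset.ne_of_mem_erase (hT hi))]
  let δ := gaussianPrivacyProfile Δ σ ε
  let G (S : Finset (Fin n)) := (projectedGaussianLaw σ c v A (∑ i ∈ S, L i (X i))).real R
  let G' (S : Finset (Fin n)) := (projectedGaussianLaw σ c v A (∑ i ∈ S, L' i (X i))).real R
  have hgauss {x y : Fin k → ℝ} (hxy : ∑ r, (x r - y r) ^ 2 ≤ Δ ^ 2) :=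
    (isIndistinguishable_iff_real (gaussianPrivacyProfile_nonneg hΔ hσ ε)).1
      (isIndistinguishable_projectedGaussianLaw c v A hΔ hσ ε hxy) R hR
  have hGreplace (T) (hT : T ⊆ M) : G (insert j T) ≤ Real.exp ε * G' (insert j T) + δ :=
    hgauss <| by
      rw [Finset.sum_insert (hjM hT), Finset.sum_insert (hjM hT), hsum T hT]
      simpa using hreplace
  have hGremove (T) (hT : T ⊆ M) (_ : T.Nonempty) : G (insert j T) ≤ Real.exp ε * G T + δ :=
    hgauss <| by simpa [Finset.sum_insert (hjM hT)] using hremove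
  have hGexchange (T) (hT : T ⊆ M) (i) (hi : i ∈ M \ T) :
      G (insert j T) ≤ Real.exp ε * G (insert i T) + δ :=
    hgauss <| by
      obtain ⟨hiM, hiT⟩ := Finset.mem_sdiff.1 hi
      simpa [Finset.sum_insert (hjM hT), Finset.sum_insert hiT] using
        hexchange i (Finset.ne_of_mem_erase hiM)
  have hmean := nonemptySubsetMean_insert_le (p := fun _ => p) (hjM subset_rfl) hp
    (Real.one_le_exp hε) (η := p / (1 - (1 - p : ℝ) ^ n)) (by simp [hMuniv])
    (fun T hT => show G' T = G T by simp only [G, G', hsum T hT]) hGreplace hGremove hGexchange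
  rw [hMuniv, ← hε'] at hmean
  rw [collaborativeInference_apply p σ c v A hh X L hR,
    collaborativeInference_apply p σ c v A hh X L' hR, ← ENNReal.ofReal_mul (Real.exp_pos _).le]
  exact (ENNReal.ofReal_le_ofReal hmean).trans ENNReal.ofReal_add_le

end CollaborativeInference

section Sensitivity

variable {l k : ℕ} {method : FusionMethod} {f g : (Fin l → ℝ) → (Fin k → ℝ)}

theorem sum_sq_meanCenter (u : Fin k → ℝ) :
    ∑ i, meanCenter u i ^ 2 = ∑ i, u i ^ 2 - (∑ i, u i) ^ 2 / k := by
  rcases Nat.eq_zero_or_pos k with rfl | hk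
  · simp
  simp only [meanCenter, sub_sq, Finset.sum_add_distrib, Finset.sum_sub_distrib, Finset.sum_const,
    ← Finset.sum_mul, ← Finset.mul_sum, Finset.card_univ, Fintype.card_fin, nsmul_eq_mul]
  field_simp
  ring

theorem sum_sq_meanCenter_le (u : Fin k → ℝ) : ∑ i, meanCenter u i ^ 2 ≤ ∑ i, u i ^ 2 :=
  sum_sq_meanCenter u ▸ sub_le_self _ (by positivity)

theorem meanCenter_sub (a b : Fin k → ℝ) : meanCenter (a - b) = meanCenter a - meanCenter b := by
  ext i
  simp only [meanCenter, Pi.sub_apply, Finset.sum_sub_distrib]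
  ring

theorem sum_sq_le_one {ι : Type*} [Fintype ι] {a : ι → ℝ} (ha : 0 ≤ a) (ha1 : ∑ i, a i ≤ 1) :
    ∑ i, a i ^ 2 ≤ 1 :=
  (Finset.sum_sq_le_sq_sum_of_nonneg fun i _ => ha i).trans
    (pow_le_one₀ (Finset.sum_nonneg fun i _ => ha i) ha1)

theorem sum_sq_sub_le_two {ι : Type*} [Fintype ι] {a b : ι → ℝ} (ha : 0 ≤ a) (hb : 0 ≤ b)
    (ha1 : ∑ i, a i ≤ 1) (hb1 : ∑ i, b i ≤ 1) : ∑ i, (a i - b i) ^ 2 ≤ 2 :=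
  calc ∑ i, (a i - b i) ^ 2
      ≤ ∑ i, (a i ^ 2 + b i ^ 2) :=
        Finset.sum_le_sum fun i _ => by nlinarith [mul_nonneg (ha i) (hb i)]
    _ = ∑ i, a i ^ 2 + ∑ i, b i ^ 2 := Finset.sum_add_distrib
    _ ≤ 2 := by linarith [sum_sq_le_one ha ha1, sum_sq_le_one hb hb1]

theorem sum_sq_meanCenter_sub_le_two {a b : Fin k → ℝ} (ha : 0 ≤ a) (hb : 0 ≤ b)
    (ha1 : ∑ i, a i ≤ 1) (hb1 : ∑ i, b i ≤ 1) :
    ∑ i, (meanCenter a i - meanCenter b i) ^ 2 ≤ 2 := by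
  have h := (sum_sq_meanCenter_le (a - b)).trans (sum_sq_sub_le_two ha hb ha1 hb1)
  rwa [meanCenter_sub] at h

namespace IsLocalModel

theorem exists_eq_meanCenter (hf : IsLocalModel method f) (x : Fin l → ℝ) :
    ∃ a : Fin k → ℝ, 0 ≤ a ∧ ∑ i, a i ≤ 1 ∧ f x = meanCenter a := by
  cases method with
  | beliefAveraging =>
    obtain ⟨r, hr, hf⟩ := hf
    exact ⟨r x, (hr x).1, (hr x).2.le, hf x⟩
  | weightedBeliefAveraging =>
    obtain ⟨r, hr, w, hw, hf⟩ := hf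
    refine ⟨_, fun i => mul_nonneg (hw.1 i) ((hr x).1 i), ?_, hf x⟩
    rw [← (hr x).2]
    exact Finset.sum_le_sum fun i _ => mul_le_of_le_one_left ((hr x).1 i) <|
      (Finset.single_le_sum (fun j _ => hw.1 j) (Finset.mem_univ i)).trans hw.2.le
  | majorityVoting =>
    obtain ⟨_, _, c, _, hf⟩ := hf
    exact ⟨_, Pi.single_nonneg.2 zero_le_one, (Fintype.sum_pi_single' _ _).le, hf x⟩

theorem sum_sq_sub_le_two (hf : IsLocalModel method f) (hg : IsLocalModel method g)
    (x y : Fin l → ℝ) : ∑ i, (f x i - g y i) ^ 2 ≤ 2 := by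
  obtain ⟨a, ha, ha1, hfx⟩ := hf.exists_eq_meanCenter x
  obtain ⟨b, hb, hb1, hgy⟩ := hg.exists_eq_meanCenter y
  rw [hfx, hgy]
  exact sum_sq_meanCenter_sub_le_two ha hb ha1 hb1

theorem sum_sq_le_two (hf : IsLocalModel method f) (x : Fin l → ℝ) : ∑ i, f x i ^ 2 ≤ 2 := by
  obtain ⟨a, ha, ha1, hfx⟩ := hf.exists_eq_meanCenter x
  rw [hfx]
  linarith [sum_sq_meanCenter_le a, sum_sq_le_one ha ha1]

end IsLocalModel

end Sensitivity

theorem theorem2_general {n l k d : ℕ} (hn : 0 < n) {p : unitInterval} (hp : 0 < p) {σ Δ : ℝ}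
    (hσ : 0 < σ) (hΔ : 0 < Δ) (c : ℝ) (v : NNReal) (A : Matrix (Fin d) (Fin k) ℝ)
    {h : Fin n → ℝ} (hh : ∀ i, h i ≠ 0) {models : Set (Fin n → (Fin l → ℝ) → (Fin k → ℝ))}
    (hdist : ∀ L ∈ models, ∀ L' ∈ models, ∀ i j x y, ∑ r, (L i x r - L' j y r) ^ 2 ≤ Δ ^ 2)
    (hnorm : ∀ L ∈ models, ∀ i x, ∑ r, L i x r ^ 2 ≤ Δ ^ 2) {ε' : ℝ} (hε' : 0 < ε') {ε δ' : ℝ}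
    (hε : ε = Real.log (1 + ((1 - (1 - (p : ℝ)) ^ n) / p) * (Real.exp ε' - 1)))
    (hδ' : δ' = (p : ℝ) / (1 - (1 - (p : ℝ)) ^ n) * gaussianPrivacyProfile Δ σ ε) :
    IsDP models (collaborativeInference p σ c v A h) ε' δ' := by
  have hp' : (0 : ℝ) < p := hp
  have hprofile := gaussianPrivacyProfile_nonneg hΔ hσ ε
  have hpD := le_one_sub_one_sub_pow hn p
  have hη : p / (1 - (1 - p : ℝ) ^ n) ∈ Set.Ioc (0 : ℝ) 1 :=
    ⟨div_pos hp' (hp'.trans_le hpD), div_le_one_of_le₀ hpD (hp'.le.trans hpD)⟩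
  obtain ⟨hε0, hexp⟩ :=
    nonneg_and_exp_eq_of_eq_log hη.1 hε'.le (hε.trans (by rw [inv_div]))
  refine ⟨hε', hδ' ▸ mul_nonneg hη.1.le hprofile, hδ' ▸ ?_, ?_⟩
  · exact (mul_le_of_le_one_left hprofile hη.2).trans_lt (gaussianPrivacyProfile_lt_one Δ σ ε)
  rintro L hL L' hL' ⟨j, -, hagree⟩ X
  rw [hδ']
  exact isIndistinguishable_collaborativeInference hp hσ hh X hΔ hε0 hexp hagree
    (hdist L hL L' hL' j j _ _) (hnorm L hL j _) fun i _ => hdist L hL L hL j i _ _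

theorem theorem2 {n l k d : ℕ} (hn : 0 < n) (method : FusionMethod)
    (p : unitInterval) (hp0 : 0 < (p : ℝ)) (hp1 : (p : ℝ) < 1)
    (σ : ℝ) (hσ : 0 < σ) (c : ℝ) (v : NNReal)
    (A : Matrix (Fin d) (Fin k) ℝ) (h : Fin n → ℝ) (hh : ∀ i, h i ≠ 0)
    (ε' : ℝ) (hε' : 0 < ε') (ε δ' : ℝ)
    (hε : ε = Real.log (1 + ((1 - (1 - (p : ℝ)) ^ n) / p) * (Real.exp ε' - 1)))
    (hδ' : δ' = (p : ℝ) / (1 - (1 - (p : ℝ)) ^ n) * fullParticipationDelta σ ε) :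
    IsDP (modelFamilies n l k method) (collaborativeInference p σ c v A h) ε' δ' := by
  have hsq : (√2 : ℝ) ^ 2 = 2 := Real.sq_sqrt zero_le_two
  exact theorem2_general hn hp0 hσ (Real.sqrt_pos.2 two_pos) c v A hh
    (fun L hL L' hL' i j x y => ((hL i).sum_sq_sub_le_two (hL' j) x y).trans_eq hsq.symm)
    (fun L hL i x => ((hL i).sum_sq_le_two x).trans_eq hsq.symm) hε' hε
    (gaussianPrivacyProfile_sqrt_two σ ε ▸ hδ')
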